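/- A simple $t$-$(v,k,\lambda)$ design is a family $T$ of distinct $k$-element subsets of $[v]=\{1,\dots,v\}$ such that every $t$-element subset of $[v]$ is contained in exactly $\lambda$ members of $T$; its size is $|T|$. Theorem (Existence of $t$-designs). There is a universal constant $c>0$ such that for all integers $v\ge1$, $1\le t\le v$ and $t\le k\le v$ there exist an integer $\lambda\ge1$ and a simple $t$-$(v,k,\lambda)$ design $T$ with $|T|\le v^{ct}$. -/

import Mathlib

/-- A simple `t`-`(v, k, l)` design on the point set `Fin v`: a family `T` of distinct `k`-element
subsets (the blocks) such that every `t`-element set of points lies in exactly `l` blocks. -/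
structure IsSimpleDesign (t v k l : ℕ) (T : Finset (Finset (Fin v))) : Prop where
  card_block : ∀ s ∈ T, s.card = k
  card_blocks_through : ∀ S : Finset (Fin v), S.card = t → (T.filter (fun s => S ⊆ s)).card = l

/-! Put V = v^t and D = t! (k choose t). If (v choose k) ≤ V^81, the complete design suffices.
Otherwise include each k-set independently with probability p, where p (v choose k) is about V^80
and the mean cover of each t-set is an integer λ divisible by D. By Fourier inversion, a design
exists if a finite sum over frequencies θ (one real weight per t-set) is positive. A term depends on
θ through the induced weights ψ(b) = ∑_{S ⊆ b} θ(S), one per k-set b.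

Far frequencies: if some ψ(b) is not within r of ℤ, a Schwartz-Zippel argument on the slice
(`choose_le_card_large_norm`), with values in ℝ/ℤ, makes many ψ(b) stay away from ℤ, and the term is
exponentially small (`norm_fourierTerm_le`).

Near frequencies: if all ψ(b) are within r of ℤ, an integer decoder with small coefficients
(`sum_decoderCoeff_mul`) recovers D θ(S) from few ψ(b). Since D divides λ, the phase of the target
then cancels the mean exactly (`fourierTerm_eq_of_near`). What remains is a product of centred
characteristic functions, whose real part is nonnegative because its total cubic error is small
(`re_prod_centered_bernoulli_char`).

Frequencies with all entries in [0, 1/W) contribute at least 1/4 each, and their share of all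
frequencies exceeds the total far error (`fourier_sum_pos`). -/

/-! ### Low-degree functions on a slice -/

open Finset in
/-- Exchanging elements one at a time turns a `k`-set into another one. -/
theorem norm_le_norm_add_of_exchange {α G : Type*} [DecidableEq α] [SeminormedAddCommGroup G]
    {U : Finset α} {k : ℕ} {f : Finset α → G} {η : ℝ}
    (h : ∀ c i j, c ⊆ U → c.card + 1 = k → i ∈ U → j ∈ U → i ∉ c → j ∉ c →
      ‖f (insert i c) - f (insert j c)‖ ≤ η) :
    ∀ (n : ℕ) (a b : Finset α), a ∈ U.powersetCard k → b ∈ U.powersetCard k → (a \ b).card = n →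
      ‖f a‖ ≤ ‖f b‖ + n * η := by
  intro n
  induction n with
  | zero =>
    intro a b ha hb hn
    rw [mem_powersetCard] at ha hb
    have hab : a ⊆ b := by simpa using hn
    have : a = b := eq_of_subset_of_card_le hab (by omega)
    simp [this]
  | succ n ih =>
    intro a b ha hb hn
    rw [mem_powersetCard] at ha hb
    have hc : (b \ a).card = n + 1 := by
      rw [← hn]; exact card_sdiff_comm (by omega)
    obtain ⟨i, hi⟩ : (a \ b).Nonempty := card_pos.1 (by omega)
    obtain ⟨j, hj⟩ : (b \ a).Nonempty := card_pos.1 (by omega)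
    rw [mem_sdiff] at hi hj
    have hjc : j ∉ a.erase i := fun hh => hj.2 (mem_of_mem_erase hh)
    have hcard : (a.erase i).card + 1 = k := by rw [card_erase_add_one hi.1, ha.2]
    have hsub : a.erase i ⊆ U := (erase_subset _ _).trans ha.1
    have h1 := h (a.erase i) i j hsub hcard (ha.1 hi.1) (hb.1 hj.1) (notMem_erase _ _) hjc
    rw [insert_erase hi.1] at h1
    have h2 := ih (insert j (a.erase i)) b
      (mem_powersetCard.2 ⟨insert_subset (hb.1 hj.1) hsub, by rw [card_insert_of_notMem hjc, hcard]⟩)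
      (mem_powersetCard.2 hb) (by
        have : insert j (a.erase i) \ b = (a \ b).erase i := by
          ext x; simp only [mem_sdiff, mem_insert, mem_erase]
          constructor
          · rintro ⟨rfl | ⟨h1, h2⟩, h3⟩
            · exact absurd hj.1 h3
            · exact ⟨h1, h2, h3⟩
          · rintro ⟨h1, h2, h3⟩; exact ⟨Or.inr ⟨h1, h2⟩, h3⟩
        rw [this, card_erase_of_mem (mem_sdiff.2 hi), hn]; rfl)
    have h3 := norm_le_norm_sub_add (f a) (f (insert j (a.erase i)))
    push_cast
    linarith

theorem choose_sub_two_mul_le {n k m : ℕ} (hm : m ≤ k) (h : k + m ≤ n) :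
    (n - 2 * m).choose (k - m) ≤ n.choose k := by
  have key : ∀ m a b : ℕ, a.choose b ≤ (a + m).choose (b + m) := by
    intro m
    induction m with
    | zero => intro a b; rfl
    | succ m ih =>
      intro a b
      refine (ih a b).trans ?_
      rw [← Nat.add_assoc, ← Nat.add_assoc, Nat.choose_succ_succ]
      exact Nat.le_add_right _ _
  have := key m (n - 2 * m) (k - m)
  rw [Nat.sub_add_cancel hm] at this
  exact this.trans (Nat.choose_le_choose _ (by omega))

-- Subsets avoiding the exchanged points cancel, so an exchange acts as a discrete derivative,
-- lowering the degree by one.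
open Finset in
theorem sum_powersetCard_insert_sub {α G : Type*} [DecidableEq α] [AddCommGroup G]
    (θ : Finset α → G) (t : ℕ) {i j : α} {c : Finset α} (hi : i ∉ c) (hj : j ∉ c) :
    (∑ S ∈ (insert i c).powersetCard (t + 1), θ S) - ∑ S ∈ (insert j c).powersetCard (t + 1), θ S
      = ∑ S ∈ c.powersetCard t, (θ (insert i S) - θ (insert j S)) := by
  have key : ∀ i ∉ c, ∑ S ∈ (insert i c).powersetCard (t + 1), θ S
      = ∑ S ∈ c.powersetCard (t + 1), θ S + ∑ S ∈ c.powersetCard t, θ (insert i S) := by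
    intro i hi
    rw [powersetCard_succ_insert hi, sum_union, sum_image]
    · intro a ha b hb hab
      have h1 : i ∉ a := fun h => hi ((mem_powersetCard.1 ha).1 h)
      have h2 : i ∉ b := fun h => hi ((mem_powersetCard.1 hb).1 h)
      rw [← erase_insert h1, ← erase_insert h2]
      exact congrArg (fun s => s.erase i) hab
    · rw [disjoint_left]
      intro a ha hb
      obtain ⟨s, -, rfl⟩ := mem_image.1 hb
      exact hi ((mem_powersetCard.1 ha).1 (mem_insert_self _ _))
  rw [key i hi, key j hj, sum_sub_distrib]
  abel

open Finset in
/-- Robust Schwartz-Zippel bound on a slice: a function on `k`-subsets of degree at most `t`, with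
values in a normed group, that is large somewhere is not small on many `k`-subsets. -/
theorem choose_le_card_large_norm {α G : Type*} [DecidableEq α] [SeminormedAddCommGroup G]
    (K : ℕ) : ∀ (t k : ℕ) (U : Finset α) (θ : Finset α → G) (ε : ℝ), 0 < ε → t ≤ k →
    k ≤ K → k + t ≤ U.card →
    (∃ b ∈ U.powersetCard k, (2 * K + 1 : ℝ) ^ t * ε < ‖∑ S ∈ b.powersetCard t, θ S‖) →
    (U.card - 2 * t).choose (k - t) ≤
      ((U.powersetCard k).filter fun b => ε < ‖∑ S ∈ b.powersetCard t, θ S‖).card := by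
  intro t
  induction t with
  | zero =>
    rintro k U θ ε - - - - ⟨b, -, hb⟩
    rw [filter_true_of_mem]
    · simp
    · intro b' _
      simpa using hb
  | succ t ih =>
    rintro k U θ ε hε htk hkK hU ⟨b₀, hb₀, hbig⟩
    set f : Finset α → G := fun b => ∑ S ∈ b.powersetCard (t + 1), θ S with hf
    change (2 * K + 1 : ℝ) ^ (t + 1) * ε < ‖f b₀‖ at hbig
    have hA : (1 : ℝ) ≤ (2 * K + 1 : ℝ) ^ t := one_le_pow₀ (by linarith [Nat.cast_nonneg (α := ℝ) K])
    -- With A = (2K+1)^t: if every exchange changes f by at most 2Aε, then at most K exchanges cost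
    -- 2KAε, and (2K+1)Aε - 2KAε = Aε ≥ ε remains at every b. Otherwise some derivative is large and
    -- induction applies to it; K stays fixed while k drops.
    by_cases H : ∀ c i j, c ⊆ U → c.card + 1 = k → i ∈ U → j ∈ U → i ∉ c → j ∉ c →
        ‖f (insert i c) - f (insert j c)‖ ≤ (2 * K + 1 : ℝ) ^ t * (2 * ε)
    · rw [filter_true_of_mem]
      · rw [card_powersetCard]; exact choose_sub_two_mul_le htk hU
      · intro b hb
        have h1 := norm_le_norm_add_of_exchange H _ b₀ b hb₀ hb rfl
        have h2 : ((b₀ \ b).card : ℝ) ≤ K := by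
          have := card_le_card (sdiff_subset (s := b₀) (t := b))
          rw [(mem_powersetCard.1 hb₀).2] at this
          exact_mod_cast this.trans hkK
        have h3 : ((b₀ \ b).card : ℝ) * ((2 * K + 1 : ℝ) ^ t * (2 * ε))
            ≤ K * ((2 * K + 1 : ℝ) ^ t * (2 * ε)) :=
          mul_le_mul_of_nonneg_right h2 (by positivity)
        have h4 : ε ≤ (2 * K + 1 : ℝ) ^ t * ε := le_mul_of_one_le_left hε.le hA
        rw [pow_succ] at hbig
        change ε < ‖f b‖
        linarith
    · push Not at H
      obtain ⟨c₀, i, j, hc₀, hck, hi, hj, hic, hjc, hlt⟩ := H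
      have hij : i ≠ j := by
        rintro rfl
        rw [sub_self, norm_zero] at hlt
        exact absurd hlt (not_lt.2 (by positivity))
      obtain ⟨k, rfl⟩ : ∃ k', k = k' + 1 := ⟨c₀.card, hck.symm⟩
      have hV : ((U.erase i).erase j).card = U.card - 2 := by
        rw [card_erase_of_mem (mem_erase.2 ⟨hij.symm, hj⟩), card_erase_of_mem hi]; omega
      have hmem : ∀ c ∈ ((U.erase i).erase j).powersetCard k, c ⊆ U ∧ c.card = k ∧ i ∉ c ∧ j ∉ c := by
        intro c hc
        rw [mem_powersetCard] at hc
        refine ⟨fun x hx => mem_of_mem_erase (mem_of_mem_erase (hc.1 hx)), hc.2, fun h => ?_,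
          fun h => ?_⟩
        · exact notMem_erase i U (mem_of_mem_erase (hc.1 h))
        · exact notMem_erase j _ (hc.1 h)
      have hdiff : ∀ c, i ∉ c → j ∉ c →
          ∑ S ∈ c.powersetCard t, (θ (insert i S) - θ (insert j S))
            = f (insert i c) - f (insert j c) :=
        fun c h1 h2 => (sum_powersetCard_insert_sub θ t h1 h2).symm
      have h1 := ih k ((U.erase i).erase j) (fun S => θ (insert i S) - θ (insert j S)) (2 * ε)
        (by linarith) (by omega) (by omega) (by omega) ⟨c₀, by
          rw [mem_powersetCard]
          refine ⟨fun x hx => mem_erase.2 ⟨?_, mem_erase.2 ⟨?_, hc₀ hx⟩⟩, by omega⟩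
          · rintro rfl; exact hjc hx
          · rintro rfl; exact hic hx, by rw [hdiff c₀ hic hjc]; exact hlt⟩
      rw [hV] at h1
      rw [show U.card - 2 * (t + 1) = U.card - 2 - 2 * t by omega,
        show k + 1 - (t + 1) = k - t by omega]
      -- A difference above 2ε forces one of its two terms above ε; erasing both i and j recovers c,
      -- so the choice is injective.
      refine h1.trans (card_le_card_of_injOn
        (fun c => if ε < ‖f (insert i c)‖ then insert i c else insert j c) ?_ ?_)
      · intro c hc
        rw [mem_coe, mem_filter] at hc
        obtain ⟨hcU, hcc, hci, hcj⟩ := hmem c hc.1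
        have h2 := hc.2
        rw [hdiff c hci hcj] at h2
        have h3 := norm_sub_le (f (insert i c)) (f (insert j c))
        rw [mem_coe, mem_filter]
        change ite _ _ _ ∈ _ ∧ ε < ‖f (ite _ _ _)‖
        split_ifs with h
        · exact ⟨mem_powersetCard.2 ⟨insert_subset hi hcU, by
            rw [card_insert_of_notMem hci, hcc]⟩, h⟩
        · exact ⟨mem_powersetCard.2 ⟨insert_subset hj hcU, by
            rw [card_insert_of_notMem hcj, hcc]⟩, by linarith⟩
      · have hrec : ∀ c, i ∉ c → j ∉ c →
            ((if ε < ‖f (insert i c)‖ then insert i c else insert j c).erase i).erase j = c := by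
          intro c h1 h2
          split_ifs
          · rw [erase_insert h1, erase_eq_of_notMem h2]
          · rw [erase_right_comm, erase_insert h2, erase_eq_of_notMem h1]
        intro c hc c' hc' hcc
        obtain ⟨-, -, hci, hcj⟩ := hmem c (mem_filter.1 hc).1
        obtain ⟨-, -, hci', hcj'⟩ := hmem c' (mem_filter.1 hc').1
        rw [← hrec c hci hcj, ← hrec c' hci' hcj']
        exact congrArg (fun s => (s.erase i).erase j) hcc

/-! ### The integer decoder -/

/-- The alternating binomial sums that make the decoder work. -/
theorem sum_range_choose_mul_decoder_coeff {n t : ℕ} (u : ℕ) (hn : n ≤ t) :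
    ∑ m ∈ Finset.range (n + 1), (n.choose m : ℤ) *
      ((-1) ^ m * ((t - m).factorial * (u + 1).ascFactorial m : ℕ) *
        (if n ≤ u + 1 + m then (t + u + 1 - n).choose (u + 1 + m - n) else 0 : ℕ))
      = if n = 0 then ((t.factorial * (t + u + 1).choose t : ℕ) : ℤ) else 0 := by
  rcases n with _ | j
  · have : (t + u + 1).choose (u + 1) = (t + u + 1).choose t := by
      rw [add_assoc, Nat.choose_symm_add]
    simp [this]
  · rw [if_neg (Nat.succ_ne_zero j)]
    -- After multiplication by u!, the ascending factorial becomes (u+m)!, and the sum is a constant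
    -- times the (j+1)-st finite difference of x ↦ (x choose j), a polynomial of degree j.
    have hu : ((u.factorial : ℕ) : ℤ) ≠ 0 := by exact_mod_cast u.factorial_ne_zero
    apply mul_left_cancel₀ hu
    rw [mul_zero, Finset.mul_sum]
    have hterm : ∀ m ∈ Finset.range (j + 1 + 1), (u.factorial : ℤ) * (((j + 1).choose m : ℤ) *
        ((-1) ^ m * ((t - m).factorial * (u + 1).ascFactorial m : ℕ) *
        (if j + 1 ≤ u + 1 + m then (t + u + 1 - (j + 1)).choose (u + 1 + m - (j + 1)) else 0 : ℕ)))
        = (-1) ^ (j + 1) * ((t + u - j).factorial * j.factorial : ℕ) *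
          (((-1) ^ (j + 1 - m) * (j + 1).choose m : ℤ) • ((u + m).choose j : ℤ)) := by
      intro m hm
      have hm' : m ≤ j + 1 := by simpa [Nat.lt_succ_iff] using hm
      have hsign : (-1 : ℤ) ^ (j + 1) * (-1) ^ (j + 1 - m) = (-1) ^ m := by
        have h1 : (-1 : ℤ) ^ (j + 1) = (-1) ^ m * (-1) ^ (j + 1 - m) := by
          rw [← pow_add]; congr 1; omega
        rw [h1, mul_assoc, ← pow_add, ← two_mul, pow_mul]; simp
      have hnat : u.factorial * ((t - m).factorial * (u + 1).ascFactorial m) *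
          (if j + 1 ≤ u + 1 + m then (t + u + 1 - (j + 1)).choose (u + 1 + m - (j + 1)) else 0)
          = (t + u - j).factorial * j.factorial * (u + m).choose j := by
        have h1 := Nat.factorial_mul_ascFactorial u m
        split_ifs with h
        · have h2 := Nat.choose_mul_factorial_mul_factorial (show u + m - j ≤ t + u - j by omega)
          have h3 := Nat.choose_mul_factorial_mul_factorial (show j ≤ u + m by omega)
          rw [show t + u - j - (u + m - j) = t - m by omega] at h2
          rw [show t + u + 1 - (j + 1) = t + u - j by omega,
            show u + 1 + m - (j + 1) = u + m - j by omega]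
          apply Nat.eq_of_mul_eq_mul_left (Nat.factorial_pos (u + m - j))
          calc _ = (u.factorial * (u + 1).ascFactorial m) * ((t + u - j).choose (u + m - j) *
                (u + m - j).factorial * (t - m).factorial) := by ring
            _ = _ := by rw [h1, h2, ← h3]; ring
        · rw [Nat.choose_eq_zero_of_lt (show u + m < j by omega), mul_zero, mul_zero]
      have hint := congrArg (Nat.cast : ℕ → ℤ) hnat
      rw [Nat.cast_mul, Nat.cast_mul] at hint
      rw [smul_eq_mul]
      calc _ = ((-1 : ℤ) ^ m * (j + 1).choose m) * ((u.factorial : ℤ) *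
            ((t - m).factorial * (u + 1).ascFactorial m : ℕ) *
            (if j + 1 ≤ u + 1 + m then (t + u + 1 - (j + 1)).choose (u + 1 + m - (j + 1))
              else 0 : ℕ)) := by ring
        _ = _ := by rw [hint, ← hsign]; push_cast; ring
    rw [Finset.sum_congr rfl hterm, ← Finset.mul_sum]
    have h0 := fwdDiff_iter_eq_sum_shift 1 (fun x : ℕ => (x.choose j : ℤ)) (j + 1) u
    have h1 : (fwdDiff 1)^[j + 1] (fun x : ℕ => (x.choose j : ℤ)) u = 0 := by
      have h2 := fwdDiff_iter_choose 0 j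
      rw [add_zero] at h2
      rw [Function.iterate_succ_apply', h2]
      simp [fwdDiff]
    rw [h1] at h0
    simp only [smul_eq_mul, mul_one] at h0 ⊢
    rw [← h0, mul_zero]

-- A subset b is encoded by R = S \ b and C = b ∩ W; the omitted part R is used because the decoder
-- coefficient depends only on its size.
open Finset in
theorem sum_powersetCard_union {α M : Type*} [DecidableEq α] [AddCommMonoid M] {S W : Finset α}
    (h : Disjoint S W) {k : ℕ} (hk : S.card ≤ k) (F : Finset α → M) :
    ∑ b ∈ (S ∪ W).powersetCard k, F b
      = ∑ R ∈ S.powerset, ∑ C ∈ W.powersetCard (k - S.card + R.card), F ((S \ R) ∪ C) := by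
  rw [sum_sigma']
  refine sum_bij' (fun b _ => ⟨S \ b, b ∩ W⟩) (fun x _ => (S \ x.1) ∪ x.2) ?_ ?_ ?_ ?_ ?_
  · intro b hb
    rw [mem_powersetCard] at hb
    rw [mem_sigma, mem_powerset, mem_powersetCard]
    refine ⟨sdiff_subset, inter_subset_right, ?_⟩
    have h1 : b = (S ∩ b) ∪ (b ∩ W) := by
      ext x
      have := @hb.1 x
      simp only [mem_union, mem_inter] at this ⊢
      tauto
    have h2 : Disjoint (S ∩ b) (b ∩ W) :=
      disjoint_of_subset_left inter_subset_left (disjoint_of_subset_right inter_subset_right h)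
    have h3 : b.card = (S ∩ b).card + (b ∩ W).card := by
      rw [← card_union_of_disjoint h2, ← h1]
    have h4 := card_inter_add_card_sdiff S b
    change (b ∩ W).card = k - S.card + (S \ b).card
    have := hb.2
    omega
  · rintro ⟨R, C⟩ hx
    rw [mem_sigma, mem_powerset, mem_powersetCard] at hx
    obtain ⟨hR, hC, hCc⟩ := hx
    change R ⊆ S at hR
    change C ⊆ W at hC
    change C.card = k - S.card + R.card at hCc
    rw [mem_powersetCard]
    refine ⟨union_subset_union sdiff_subset hC, ?_⟩
    rw [card_union_of_disjoint (disjoint_of_subset_left sdiff_subset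
      (disjoint_of_subset_right hC h)), card_sdiff_of_subset hR]
    have := card_le_card hR
    change S.card - R.card + C.card = k
    omega
  · intro b hb
    rw [mem_powersetCard] at hb
    ext x
    have := @hb.1 x
    simp only [mem_union, mem_inter, mem_sdiff] at this ⊢
    tauto
  · rintro ⟨R, C⟩ hx
    rw [mem_sigma, mem_powerset, mem_powersetCard] at hx
    obtain ⟨hR, hC, -⟩ := hx
    change R ⊆ S at hR
    change C ⊆ W at hC
    rw [disjoint_left] at h
    have h1 : S \ ((S \ R) ∪ C) = R := by
      ext x
      have := @hR x; have := @hC x; have := @h x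
      simp only [mem_union, mem_sdiff]
      tauto
    have h2 : ((S \ R) ∪ C) ∩ W = C := by
      ext x
      have := @hR x; have := @hC x; have := @h x
      simp only [mem_union, mem_sdiff, mem_inter]
      tauto
    change (⟨S \ ((S \ R) ∪ C), ((S \ R) ∪ C) ∩ W⟩ : (_ : Finset α) × Finset α) = ⟨R, C⟩
    rw [h1, h2]
  · intro b hb
    rw [mem_powersetCard] at hb
    congr 1
    ext x
    have := @hb.1 x
    simp only [mem_union, mem_inter, mem_sdiff] at this ⊢
    tauto

/-- The coefficient of the `(t+u+1)`-set `b` in the decoder of the `t`-set `S`. -/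
def decoderCoeff {α : Type*} [DecidableEq α] (t u : ℕ) (S b : Finset α) : ℤ :=
  (-1) ^ (S \ b).card * ((t - (S \ b).card).factorial * (u + 1).ascFactorial (S \ b).card : ℕ)

-- S' ⊆ b means R = S \ b lies in S \ S' and b ∩ W contains S' ∩ W. With n = |S \ S'| = |S' ∩ W|,
-- counting b for fixed R and then grouping by |R| gives the alternating sum, which vanishes unless
-- n = 0.
open Finset in
theorem sum_filter_decoderCoeff {α : Type*} [DecidableEq α] {t u : ℕ} {S W S' : Finset α}
    (h : Disjoint S W) (hS : S.card = t) (hW : W.card = t + u + 1)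
    (hS' : S' ∈ (S ∪ W).powersetCard t) :
    ∑ b ∈ (S ∪ W).powersetCard (t + u + 1), (if S' ⊆ b then decoderCoeff t u S b else 0)
      = if S' = S then ((t.factorial * (t + u + 1).choose t : ℕ) : ℤ) else 0 := by
  rw [mem_powersetCard] at hS'
  rw [sum_powersetCard_union h (by omega)]
  set n := (S \ S').card with hn
  have hnt : n ≤ t := by rw [← hS]; exact card_le_card sdiff_subset
  have hn' : (S' ∩ W).card = n := by
    have h1 : S' \ S = S' ∩ W := by
      rw [disjoint_left] at h
      ext x
      have h1 := @hS'.1 x; have h2 := @h x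
      simp only [mem_union, mem_sdiff, mem_inter] at h1 ⊢
      tauto
    rw [← h1]; exact card_sdiff_comm (by omega)
  have hinner : ∀ R ∈ S.powerset, ∑ C ∈ W.powersetCard (t + u + 1 - S.card + R.card),
      (if S' ⊆ (S \ R) ∪ C then decoderCoeff t u S ((S \ R) ∪ C) else 0)
      = if R ⊆ S \ S' then
        (-1 : ℤ) ^ R.card * ((t - R.card).factorial * (u + 1).ascFactorial R.card : ℕ) *
        (if n ≤ u + 1 + R.card then (t + u + 1 - n).choose (u + 1 + R.card - n) else 0 : ℕ)
        else 0 := by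
    intro R hR
    rw [mem_powerset] at hR
    have hcond : ∀ C ⊆ W, (S' ⊆ (S \ R) ∪ C ↔ R ⊆ S \ S' ∧ S' ∩ W ⊆ C) := by
      intro C hC
      rw [disjoint_left] at h
      simp only [subset_iff, mem_union, mem_sdiff, mem_inter] at *
      constructor
      · intro H
        refine ⟨fun x hx => ⟨hR hx, fun hx' => ?_⟩, fun x hx => ?_⟩
        · rcases H hx' with h1 | h1
          · exact h1.2 hx
          · exact h (hR hx) (hC h1)
        · rcases H hx.1 with h1 | h1
          · exact absurd hx.2 (h h1.1)
          · exact h1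
      · rintro ⟨H1, H2⟩ x hx
        rcases hS'.1 hx with h1 | h1
        · exact Or.inl ⟨h1, fun h2 => (H1 h2).2 hx⟩
        · exact Or.inr (H2 ⟨hx, h1⟩)
    have hcoef : ∀ C ⊆ W, decoderCoeff t u S ((S \ R) ∪ C)
        = (-1) ^ R.card * ((t - R.card).factorial * (u + 1).ascFactorial R.card : ℕ) := by
      intro C hC
      have h1 : S \ ((S \ R) ∪ C) = R := by
        rw [disjoint_left] at h
        ext x
        have := @hR x; have := @hC x; have := @h x
        simp only [mem_union, mem_sdiff]
        tauto
      rw [decoderCoeff, h1]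
    rw [show t + u + 1 - S.card + R.card = u + 1 + R.card by omega]
    split_ifs with hRS hle
    · have hX := card_filter_powersetCard_subset (S' ∩ W) W (u + 1 + R.card) inter_subset_right
        (by omega)
      rw [hn', hW] at hX
      rw [← hX, mul_comm, ← nsmul_eq_mul, ← sum_const, sum_filter]
      refine sum_congr rfl fun C hC => ?_
      have hCW := (mem_powersetCard.1 hC).1
      simp [hcond C hCW, hcoef C hCW, hRS]
    · refine (sum_eq_zero fun C hC => ?_).trans (by simp)
      rw [mem_powersetCard] at hC
      rw [if_neg]
      rw [hcond C hC.1]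
      rintro ⟨-, h1⟩
      have := card_le_card h1
      omega
    · refine sum_eq_zero fun C hC => ?_
      rw [if_neg]
      rw [hcond C (mem_powersetCard.1 hC).1]
      exact fun hh => hRS hh.1
  rw [sum_congr rfl hinner, ← sum_filter]
  have hfil : S.powerset.filter (fun R => R ⊆ S \ S') = (S \ S').powerset := by
    ext R
    simp only [mem_filter, mem_powerset]
    exact ⟨fun hh => hh.2, fun hh => ⟨hh.trans sdiff_subset, hh⟩⟩
  rw [hfil, sum_powerset_apply_card (fun m => (-1 : ℤ) ^ m *
    ((t - m).factorial * (u + 1).ascFactorial m : ℕ) *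
    (if n ≤ u + 1 + m then (t + u + 1 - n).choose (u + 1 + m - n) else 0 : ℕ))]
  simp only [nsmul_eq_mul]
  rw [sum_range_choose_mul_decoder_coeff u hnt]
  have : n = 0 ↔ S' = S := by
    rw [hn, card_eq_zero, sdiff_eq_empty_iff_subset]
    exact ⟨fun hh => (eq_of_subset_of_card_le hh (by omega)).symm, fun hh => hh ▸ Subset.rfl⟩
  simp only [this]

open Finset in
/-- The decoder recovers a multiple of the weight of a single `t`-set from the induced weights
of `(t+u+1)`-sets. -/
theorem sum_decoderCoeff_mul {α : Type*} [DecidableEq α] {t u : ℕ} {S W : Finset α}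
    (h : Disjoint S W) (hS : S.card = t) (hW : W.card = t + u + 1) (θ : Finset α → ℝ) :
    ∑ b ∈ (S ∪ W).powersetCard (t + u + 1),
      (decoderCoeff t u S b : ℝ) * ∑ S' ∈ b.powersetCard t, θ S'
      = (t.factorial * (t + u + 1).choose t : ℕ) * θ S := by
  have h1 : ∀ b ∈ (S ∪ W).powersetCard (t + u + 1),
      (decoderCoeff t u S b : ℝ) * ∑ S' ∈ b.powersetCard t, θ S'
      = ∑ S' ∈ (S ∪ W).powersetCard t,
        ((if S' ⊆ b then decoderCoeff t u S b else 0 : ℤ) : ℝ) * θ S' := by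
    intro b hb
    have hb' := (mem_powersetCard.1 hb).1
    have h2 : b.powersetCard t = ((S ∪ W).powersetCard t).filter (fun S' => S' ⊆ b) := by
      ext x
      simp only [mem_powersetCard, mem_filter]
      exact ⟨fun hx => ⟨⟨hx.1.trans hb', hx.2⟩, hx.1⟩, fun hx => ⟨hx.2, hx.1.2⟩⟩
    rw [h2, mul_sum, sum_filter]
    refine sum_congr rfl fun S' _ => ?_
    split_ifs <;> simp
  rw [sum_congr rfl h1, sum_comm]
  have h3 : ∀ S' ∈ (S ∪ W).powersetCard t, ∑ b ∈ (S ∪ W).powersetCard (t + u + 1),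
      ((if S' ⊆ b then decoderCoeff t u S b else 0 : ℤ) : ℝ) * θ S'
      = if S' = S then ((t.factorial * (t + u + 1).choose t : ℕ) : ℝ) * θ S else 0 := by
    intro S' hS'
    rw [← sum_mul, ← Int.cast_sum, sum_filter_decoderCoeff h hS hW hS']
    split_ifs with hh
    · rw [hh, Int.cast_natCast]
    · simp
  rw [sum_congr rfl h3, sum_ite_eq', if_pos]
  exact mem_powersetCard.2 ⟨subset_union_left, hS⟩

/-! ### Characters and Fourier inversion -/

/-- The character `x ↦ exp (2πix)` of the real line. -/
noncomputable def cis (x : ℝ) : ℂ := Complex.exp ((2 * Real.pi * x : ℝ) * Complex.I)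

theorem cis_zero : cis 0 = 1 := by simp [cis]

theorem cis_add (x y : ℝ) : cis (x + y) = cis x * cis y := by
  rw [cis, cis, cis, ← Complex.exp_add]; congr 1; push_cast; ring

theorem cis_sum {ι : Type*} (s : Finset ι) (f : ι → ℝ) : cis (∑ i ∈ s, f i) = ∏ i ∈ s, cis (f i) := by
  classical
  induction s using Finset.induction_on with
  | empty => simp [cis_zero]
  | insert a s ha ih => rw [Finset.sum_insert ha, Finset.prod_insert ha, cis_add, ih]

theorem norm_cis (x : ℝ) : ‖cis x‖ = 1 := Complex.norm_exp_ofReal_mul_I _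

theorem cis_intCast (n : ℤ) : cis n = 1 := by
  rw [cis, Complex.exp_eq_one_iff]; exact ⟨n, by push_cast; ring⟩

theorem cis_eq_one_iff {x : ℝ} : cis x = 1 ↔ ∃ n : ℤ, x = n := by
  refine ⟨fun h => ?_, fun ⟨n, hn⟩ => hn ▸ cis_intCast n⟩
  rw [cis, Complex.exp_eq_one_iff] at h
  obtain ⟨n, hn⟩ := h
  refine ⟨n, ?_⟩
  have h1 : ((2 * Real.pi * x : ℝ) : ℂ) = (2 * Real.pi * n : ℝ) := by
    apply mul_right_cancel₀ Complex.I_ne_zero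
    rw [hn]; push_cast; ring
  have h2 : 2 * Real.pi * x = 2 * Real.pi * n := by exact_mod_cast h1
  exact mul_left_cancel₀ (by positivity) h2

theorem cis_eq_of_sub_int {x y : ℝ} (h : ∃ n : ℤ, x - y = n) : cis x = cis y := by
  obtain ⟨n, hn⟩ := h
  rw [show x = y + n by linarith, cis_add, cis_intCast, mul_one]

theorem cis_natCast_mul (n : ℕ) (x : ℝ) : cis (n * x) = cis x ^ n := by
  induction n with
  | zero => simp [cis_zero]
  | succ n ih => rw [Nat.cast_succ, add_one_mul, cis_add, ih, pow_succ]

theorem sum_fin_cis_eq_zero {Q : ℕ} {m : ℤ} (hm : m ≠ 0) (hmQ : |m| < Q) :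
    ∑ c : Fin Q, cis (m * ((c : ℕ) / Q : ℝ)) = 0 := by
  have hQ : (Q : ℝ) ≠ 0 := by
    have : (0 : ℤ) < Q := (abs_nonneg m).trans_lt hmQ
    exact_mod_cast this.ne'
  have h1 : ∀ c : Fin Q, cis (m * ((c : ℕ) / Q : ℝ)) = cis (m / Q) ^ (c : ℕ) := by
    intro c
    rw [← cis_natCast_mul]; congr 1; ring
  rw [Finset.sum_congr rfl fun c _ => h1 c, Fin.sum_univ_eq_sum_range (fun c => cis (m / Q) ^ c)]
  have h2 : cis (m / Q) ≠ 1 := by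
    rw [Ne, cis_eq_one_iff]
    rintro ⟨n, hn⟩
    rw [div_eq_iff hQ] at hn
    have hn' : m = n * Q := by exact_mod_cast hn
    exact hm (Int.eq_zero_of_abs_lt_dvd ⟨n, by rw [hn']; ring⟩ hmQ)
  have h3 := mul_geom_sum (cis (m / Q)) Q
  rw [← cis_natCast_mul, mul_div_cancel₀ _ hQ, cis_intCast, sub_self] at h3
  exact (mul_eq_zero.1 h3).resolve_left (sub_ne_zero.2 h2)

open Finset in
/-- Fourier inversion over `(ℤ/Q)^ι` for the sum of a `p`-random subset of a family of integer
vectors: if the integral representing the probability of `x` is positive, `x` is attained. -/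
theorem exists_subset_sum_eq {ι β : Type*} [Fintype ι] [DecidableEq ι] [DecidableEq β]
    (B : Finset β) (φ : β → ι → ℤ) (x : ι → ℤ) (p : ℝ) (Q : ℕ)
    (hQ : ∀ T ⊆ B, ∀ i, |∑ b ∈ T, φ b i - x i| < Q)
    (hpos : 0 < (∑ a : ι → Fin Q, cis (-∑ i, x i * ((a i : ℕ) / Q : ℝ)) *
      ∏ b ∈ B, ((1 - p : ℝ) + p * cis (∑ i, φ b i * ((a i : ℕ) / Q : ℝ)))).re) :
    ∃ T ⊆ B, ∀ i, ∑ b ∈ T, φ b i = x i := by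
  by_contra hcon
  push Not at hcon
  refine hpos.ne' ?_
  -- Expanding over T and summing over frequencies factors by coordinate; if T misses x in some
  -- coordinate, that factor is a full nontrivial character sum.
  have hterm : ∀ a : ι → Fin Q, cis (-∑ i, x i * ((a i : ℕ) / Q : ℝ)) *
      ∏ b ∈ B, ((1 - p : ℝ) + p * cis (∑ i, φ b i * ((a i : ℕ) / Q : ℝ)))
      = ∑ T ∈ B.powerset, ((p : ℂ) ^ T.card * ((1 - p : ℝ) : ℂ) ^ (B \ T).card) *
        ∏ i, cis ((∑ b ∈ T, φ b i - x i : ℤ) * ((a i : ℕ) / Q : ℝ)) := by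
    intro a
    simp only [add_comm ((1 - p : ℝ) : ℂ)]
    rw [prod_add, mul_sum]
    refine sum_congr rfl fun T _ => ?_
    rw [prod_mul_distrib, prod_const, prod_const, ← cis_sum, ← cis_sum]
    have h1 : ∑ i, ((∑ b ∈ T, φ b i - x i : ℤ) * ((a i : ℕ) / Q : ℝ))
        = -∑ i, x i * ((a i : ℕ) / Q : ℝ) + ∑ b ∈ T, ∑ i, φ b i * ((a i : ℕ) / Q : ℝ) := by
      rw [sum_comm, ← sum_neg_distrib, ← sum_add_distrib]
      refine sum_congr rfl fun i _ => ?_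
      push_cast
      rw [sub_mul, sum_mul]; ring
    rw [h1, cis_add]; ring
  rw [sum_congr rfl fun a _ => hterm a, sum_comm, sum_eq_zero, Complex.zero_re]
  intro T hT
  rw [mem_powerset] at hT
  obtain ⟨i, hi⟩ := hcon T hT
  rw [← mul_sum]
  have h2 := prod_univ_sum (fun _ : ι => (univ : Finset (Fin Q)))
    (fun i c => cis ((∑ b ∈ T, φ b i - x i : ℤ) * ((c : ℕ) / Q : ℝ)))
  rw [Fintype.piFinset_univ] at h2
  rw [← h2, prod_eq_zero (mem_univ i), mul_zero]
  exact sum_fin_cis_eq_zero (sub_ne_zero.2 hi) (hQ T hT i)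

/-! ### Bernoulli characteristic functions -/

/-- The squared norm is 1 - 2p(1-p)(1 - cos 2πy), where 1 - p ≥ 1/2 and 1 - cos 2πy ≥ 8y². -/
theorem norm_bernoulli_char_le {p y : ℝ} (hp0 : 0 ≤ p) (hp : p ≤ 1 / 2) (hy : |y| ≤ 1 / 2) :
    ‖((1 - p : ℝ) : ℂ) + p * cis y‖ ≤ Real.exp (-(4 * p * y ^ 2)) := by
  have hcos : Real.cos (2 * Real.pi * y) ≤ 1 - 8 * y ^ 2 := by
    have h := Real.cos_le_one_sub_mul_cos_sq (x := 2 * Real.pi * y) (by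
      rw [abs_mul, abs_of_pos Real.two_pi_pos]
      nlinarith [Real.pi_pos])
    have : 2 / Real.pi ^ 2 * (2 * Real.pi * y) ^ 2 = 8 * y ^ 2 := by
      field_simp [Real.pi_ne_zero]; ring
    linarith
  have hsq : ‖((1 - p : ℝ) : ℂ) + p * cis y‖ ^ 2
      = 1 - 2 * p * (1 - p) * (1 - Real.cos (2 * Real.pi * y)) := by
    rw [← Complex.normSq_eq_norm_sq, Complex.normSq_apply, cis, Complex.exp_mul_I,
      ← Complex.ofReal_cos, ← Complex.ofReal_sin]
    simp only [Complex.add_re, Complex.add_im, Complex.mul_re, Complex.mul_im, Complex.ofReal_re,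
      Complex.ofReal_im, Complex.I_re, Complex.I_im]
    have := Real.sin_sq_add_cos_sq (2 * Real.pi * y)
    linear_combination p ^ 2 * this
  have h1 : ‖((1 - p : ℝ) : ℂ) + p * cis y‖ ^ 2 ≤ Real.exp (-(4 * p * y ^ 2)) ^ 2 := by
    rw [hsq, ← Real.exp_nat_mul]
    have h2 := Real.add_one_le_exp (((2 : ℕ) : ℝ) * -(4 * p * y ^ 2))
    refine le_trans ?_ h2
    have h3 : p * (1 / 2) * (8 * y ^ 2) ≤ p * (1 - p) * (1 - Real.cos (2 * Real.pi * y)) := by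
      apply mul_le_mul
      · exact mul_le_mul_of_nonneg_left (by linarith) hp0
      · linarith
      · positivity
      · exact mul_nonneg hp0 (by linarith)
    push_cast
    linarith
  exact le_of_sq_le_sq h1 (Real.exp_pos _).le

/-- Second order expansion of the characteristic function of a centred Bernoulli variable. -/
theorem exists_centered_bernoulli_char_eq {p y : ℝ} (hp0 : 0 ≤ p) (hp : p ≤ 1 / 2)
    (hy : 7 * |y| ≤ 1) :
    ∃ (q : ℝ) (u : ℂ), cis (-(p * y)) * (((1 - p : ℝ) : ℂ) + p * cis y) = q * (1 + u) ∧
      0 < q ∧ q ≤ 1 ∧ 1 - 20 * p * y ^ 2 ≤ q ∧ ‖u‖ ≤ 250 * p * |y| ^ 3 := by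
  set α := 2 * Real.pi * y with hα
  have hπ := Real.pi_lt_d4
  have hπ0 := Real.pi_gt_three
  -- Numerical constants: 2π < 7, (2π)² ≤ 40 (halved to give 20) and (2π)³ ≤ 250.
  have hα1 : |α| ≤ 1 := by
    rw [hα, abs_mul, abs_of_pos Real.two_pi_pos]
    nlinarith [abs_nonneg y]
  have hα3 : |α| ^ 3 ≤ 250 * |y| ^ 3 := by
    rw [hα, abs_mul, abs_of_pos Real.two_pi_pos, mul_pow]
    apply mul_le_mul_of_nonneg_right _ (by positivity)
    have : (2 * Real.pi) ^ 3 ≤ 6.2832 ^ 3 := by gcongr; linarith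
    norm_num at this ⊢
    linarith
  have hα2 : α ^ 2 ≤ 40 * y ^ 2 := by
    rw [hα, mul_pow]
    apply mul_le_mul_of_nonneg_right _ (by positivity)
    nlinarith
  have hexp : ∀ s : ℝ, |s| ≤ 1 →
      ‖Complex.exp ((s * α : ℝ) * Complex.I) - (1 + (s * α : ℝ) * Complex.I - ((s * α) ^ 2 / 2 : ℝ))‖
        ≤ |s| * |α| ^ 3 * (2 / 9) := by
    intro s hs
    have h0 : ‖((s * α : ℝ) : ℂ) * Complex.I‖ = |s| * |α| := by
      rw [norm_mul, Complex.norm_I, mul_one, Complex.norm_real, Real.norm_eq_abs, abs_mul]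
    have h1 := Complex.exp_bound (x := ((s * α : ℝ) : ℂ) * Complex.I)
      (by rw [h0]; exact mul_le_one₀ hs (abs_nonneg _) hα1) (show 0 < 3 by norm_num)
    rw [h0] at h1
    have h2 : ∑ m ∈ Finset.range 3, (((s * α : ℝ) : ℂ) * Complex.I) ^ m / (m.factorial : ℂ)
        = 1 + (s * α : ℝ) * Complex.I - ((s * α) ^ 2 / 2 : ℝ) := by
      simp only [Finset.sum_range_succ, Finset.sum_range_zero, Nat.factorial, mul_pow, Complex.I_sq]
      push_cast; ring
    rw [h2] at h1
    refine h1.trans ?_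
    have h3 : (|s| * |α|) ^ 3 ≤ |s| * |α| ^ 3 := by
      rw [mul_pow]
      apply mul_le_mul_of_nonneg_right _ (by positivity)
      exact pow_le_of_le_one (abs_nonneg _) hs (by norm_num)
    have h4 : (((3 : ℕ).succ : ℝ) * (((3 : ℕ).factorial : ℝ) * ((3 : ℕ) : ℝ))⁻¹) = 2 / 9 := by
      norm_num [Nat.factorial]
    rw [h4]
    exact mul_le_mul_of_nonneg_right h3 (by norm_num)
  -- The second-order Taylor value: after centring, the frequencies are -pα and (1-p)α with weights
  -- 1-p and p, so linear terms cancel and the variance p(1-p) remains.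
  set q : ℝ := 1 - p * (1 - p) * α ^ 2 / 2 with hq
  have hpp : 0 ≤ p * (1 - p) := mul_nonneg hp0 (by linarith)
  have hpp4 : p * (1 - p) ≤ 1 / 4 := by nlinarith [sq_nonneg (p - 1 / 2)]
  have hα2' : α ^ 2 ≤ 1 := by rw [← sq_abs]; exact pow_le_one₀ (abs_nonneg _) hα1
  have hq78 : 7 / 8 ≤ q := by
    have := mul_le_mul hpp4 hα2' (sq_nonneg α) (by norm_num)
    rw [hq]; linarith
  set z : ℂ := cis (-(p * y)) * (((1 - p : ℝ) : ℂ) + p * cis y) with hz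
  have hzeq : z = (1 - p : ℝ) * Complex.exp ((-p * α : ℝ) * Complex.I)
      + (p : ℝ) * Complex.exp (((1 - p) * α : ℝ) * Complex.I) := by
    have h1 : cis (-(p * y)) = Complex.exp ((-p * α : ℝ) * Complex.I) := by
      rw [cis]; congr 3; rw [hα]; ring
    have h2 : cis (-(p * y)) * cis y = Complex.exp (((1 - p) * α : ℝ) * Complex.I) := by
      rw [← cis_add, cis]; congr 3; rw [hα]; ring
    rw [hz, mul_add, ← h1, ← h2]; ring
  have hzq : ‖z - q‖ ≤ p * |α| ^ 3 * (4 / 9) := by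
    have h1 := hexp (-p) (by rw [abs_neg, abs_of_nonneg hp0]; linarith)
    have h2 := hexp (1 - p) (by rw [abs_of_nonneg (by linarith)]; linarith)
    rw [abs_neg, abs_of_nonneg hp0] at h1
    rw [abs_of_nonneg (show 0 ≤ 1 - p by linarith)] at h2
    set E1 := Complex.exp ((-p * α : ℝ) * Complex.I)
    set E2 := Complex.exp (((1 - p) * α : ℝ) * Complex.I)
    have h3 : z - q = (1 - p : ℝ) * (E1 - (1 + (-p * α : ℝ) * Complex.I - ((-p * α) ^ 2 / 2 : ℝ)))
        + (p : ℝ) * (E2 - (1 + ((1 - p) * α : ℝ) * Complex.I - (((1 - p) * α) ^ 2 / 2 : ℝ))) := by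
      rw [hzeq, hq]; push_cast; ring
    rw [h3]
    refine (norm_add_le _ _).trans ?_
    rw [norm_mul, norm_mul, Complex.norm_real, Complex.norm_real, Real.norm_eq_abs,
      Real.norm_eq_abs, abs_of_nonneg (show 0 ≤ 1 - p by linarith), abs_of_nonneg hp0]
    have h4 := mul_le_mul_of_nonneg_left h1 (show 0 ≤ 1 - p by linarith)
    have h5 := mul_le_mul_of_nonneg_left h2 hp0
    have h6 : (1 - p) * (p * |α| ^ 3 * (2 / 9)) ≤ 1 * (p * |α| ^ 3 * (2 / 9)) :=
      mul_le_mul_of_nonneg_right (by linarith) (by positivity)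
    have h7 : p * ((1 - p) * |α| ^ 3 * (2 / 9)) = (1 - p) * (p * |α| ^ 3 * (2 / 9)) := by ring
    linarith
  have hq0 : (q : ℂ) ≠ 0 := by exact_mod_cast (show q ≠ 0 by linarith)
  refine ⟨q, (z - q) / q, by field_simp; ring, by linarith, ?_, ?_, ?_⟩
  · rw [hq]; nlinarith [mul_nonneg hpp (sq_nonneg α)]
  · have h1 : p * (1 - p) * α ^ 2 ≤ p * (40 * y ^ 2) :=
      mul_le_mul (mul_le_of_le_one_right hp0 (by linarith)) hα2 (sq_nonneg _) hp0
    rw [hq]; linarith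
  · rw [norm_div, Complex.norm_real, Real.norm_eq_abs, abs_of_pos (show 0 < q by linarith),
      div_le_iff₀ (by linarith)]
    have h1 : p * |α| ^ 3 ≤ p * (250 * |y| ^ 3) := mul_le_mul_of_nonneg_left hα3 hp0
    have h2 : 0 ≤ p * |y| ^ 3 := by positivity
    nlinarith

theorem one_sub_sum_le_prod_of_le {β : Type*} (B : Finset β) {q s : β → ℝ}
    (h0 : ∀ b ∈ B, 0 ≤ q b) (h1 : ∀ b ∈ B, q b ≤ 1) (h : ∀ b ∈ B, 1 - s b ≤ q b) :
    1 - ∑ b ∈ B, s b ≤ ∏ b ∈ B, q b := by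
  classical
  induction B using Finset.induction_on with
  | empty => simp
  | insert a B ha ih =>
    rw [Finset.sum_insert ha, Finset.prod_insert ha]
    have hB : ∀ b ∈ B, b ∈ insert a B := fun b hb => Finset.mem_insert_of_mem hb
    have h2 := ih (fun b hb => h0 b (hB b hb)) (fun b hb => h1 b (hB b hb)) fun b hb => h b (hB b hb)
    have h3 : ∏ b ∈ B, q b ≤ 1 :=
      Finset.prod_le_one (fun b hb => h0 b (hB b hb)) fun b hb => h1 b (hB b hb)
    have ha' := Finset.mem_insert_self a B
    have h4 := h1 a ha'
    have h5 := h a ha'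
    nlinarith [mul_nonneg (sub_nonneg.2 h4) (sub_nonneg.2 h3)]

/-- The product is the positive real ∏ q times ∏ (1 + u) with ∑ ‖u‖ ≤ 250 p |B| r³ ≤ 1/3. The latter
factor is within e^{1/3} - 1 ≤ 1/2 of 1, so at least half of ∏ q survives. -/
theorem re_prod_centered_bernoulli_char {β : Type*} (B : Finset β) {y : β → ℝ} {p r : ℝ}
    (hp0 : 0 ≤ p) (hp : p ≤ 1 / 2) (hy : ∀ b ∈ B, |y b| ≤ r) (hr : 7 * r ≤ 1)
    (hN : 750 * (p * B.card) * r ^ 3 ≤ 1) :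
    0 ≤ (∏ b ∈ B, (cis (-(p * y b)) * (((1 - p : ℝ) : ℂ) + p * cis (y b)))).re ∧
    (1 - 20 * p * ∑ b ∈ B, y b ^ 2) / 2
      ≤ (∏ b ∈ B, (cis (-(p * y b)) * (((1 - p : ℝ) : ℂ) + p * cis (y b)))).re := by
  have hex : ∀ b : β, ∃ (q : ℝ) (u : ℂ), b ∈ B →
      cis (-(p * y b)) * (((1 - p : ℝ) : ℂ) + p * cis (y b)) = q * (1 + u) ∧
      0 < q ∧ q ≤ 1 ∧ 1 - 20 * p * y b ^ 2 ≤ q ∧ ‖u‖ ≤ 250 * p * |y b| ^ 3 := by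
    intro b
    by_cases hb : b ∈ B
    · obtain ⟨q, u, h⟩ := exists_centered_bernoulli_char_eq (y := y b) hp0 hp
        (by linarith [hy b hb])
      exact ⟨q, u, fun _ => h⟩
    · exact ⟨0, 0, fun h => absurd h hb⟩
  choose q u hqu using hex
  have hprod : ∏ b ∈ B, (cis (-(p * y b)) * (((1 - p : ℝ) : ℂ) + p * cis (y b)))
      = ((∏ b ∈ B, q b : ℝ) : ℂ) * ∏ b ∈ B, (1 + u b) := by
    rw [Complex.ofReal_prod, ← Finset.prod_mul_distrib]
    exact Finset.prod_congr rfl fun b hb => (hqu b hb).1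
  have hsum : ∑ b ∈ B, ‖u b‖ ≤ 1 / 3 := by
    have h1 : ∑ b ∈ B, ‖u b‖ ≤ ∑ _b ∈ B, 250 * p * r ^ 3 := by
      refine Finset.sum_le_sum fun b hb => (hqu b hb).2.2.2.2.trans ?_
      have := hy b hb
      gcongr
    rw [Finset.sum_const, nsmul_eq_mul] at h1
    linarith
  have hnorm := (Finset.norm_prod_one_add_sub_one_le B u).trans
    (sub_le_sub_right (Real.exp_le_exp.2 hsum) 1)
  have hexp : Real.exp (1 / 3) ≤ 3 / 2 := by
    have h := Real.exp_bound_div_one_sub_of_interval (x := 1 / 3) (by norm_num) (by norm_num)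
    norm_num at h ⊢
    exact h
  have hre : 1 / 2 ≤ (∏ b ∈ B, (1 + u b)).re := by
    have h1 := (Complex.abs_re_le_norm (∏ b ∈ B, (1 + u b) - 1)).trans hnorm
    rw [Complex.sub_re, Complex.one_re] at h1
    have := (abs_le.1 h1).1
    linarith
  have hq0 : 0 ≤ ∏ b ∈ B, q b := Finset.prod_nonneg fun b hb => (hqu b hb).2.1.le
  have hq1 : 1 - ∑ b ∈ B, 20 * p * y b ^ 2 ≤ ∏ b ∈ B, q b :=
    one_sub_sum_le_prod_of_le B (fun b hb => (hqu b hb).2.1.le) (fun b hb => (hqu b hb).2.2.1)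
      fun b hb => (hqu b hb).2.2.2.1
  rw [← Finset.mul_sum] at hq1
  rw [hprod, Complex.re_ofReal_mul]
  have h2 := mul_le_mul_of_nonneg_left hre hq0
  constructor <;> linarith

/-! ### Near and far frequencies -/

/-- Double count k-sets with t points marked inside and t outside. The Schwartz-Zippel count is thus
at least a v^(-2t) fraction of all k-sets. -/
theorem choose_le_pow_mul_choose_sub {v k t : ℕ} (htk : t ≤ k) (h : k + t ≤ v) :
    v.choose k ≤ (v ^ t) ^ 2 * (v - 2 * t).choose (k - t) := by
  have h1 := Nat.choose_mul (n := v) (k := k) (s := t) htk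
  have h2 := Nat.choose_mul (n := v - t) (k := v - k) (s := t) (by omega)
  have h3 : (v - t).choose (v - k) = (v - t).choose (k - t) := by
    rw [← Nat.choose_symm (show k - t ≤ v - t by omega)]; congr 1; omega
  have h4 : (v - t - t).choose (v - k - t) = (v - 2 * t).choose (k - t) := by
    rw [← Nat.choose_symm (show k - t ≤ v - 2 * t by omega)]; congr 1 <;> omega
  rw [h3, h4] at h2
  calc v.choose k ≤ v.choose k * (k.choose t * (v - k).choose t) :=
        Nat.le_mul_of_pos_right _ (Nat.mul_pos (Nat.choose_pos htk) (Nat.choose_pos (by omega)))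
    _ = v.choose t * ((v - t).choose (k - t) * (v - k).choose t) := by
        rw [← mul_assoc, h1, mul_assoc]
    _ = v.choose t * (v - t).choose t * (v - 2 * t).choose (k - t) := by rw [h2, mul_assoc]
    _ ≤ v ^ t * v ^ t * (v - 2 * t).choose (k - t) := by
        apply Nat.mul_le_mul_right
        exact Nat.mul_le_mul (Nat.choose_le_pow _ _) ((Nat.choose_le_pow _ _).trans
          (Nat.pow_le_pow_left (Nat.sub_le _ _) _))
    _ = _ := by ring

open Finset in
theorem sum_abs_decoderCoeff_le {α : Type*} [DecidableEq α] {t u v : ℕ} {S W : Finset α}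
    (h : Disjoint S W) (hS : S.card = t) (hW : W.card = t + u + 1) (hv : t + u + 1 + t ≤ v) :
    ∑ b ∈ (S ∪ W).powersetCard (t + u + 1), |(decoderCoeff t u S b : ℝ)| ≤ ((v : ℝ) ^ t) ^ 2 := by
  have h1 : ∀ b, |(decoderCoeff t u S b : ℝ)| ≤ (v : ℝ) ^ t := by
    intro b
    have hm : (S \ b).card ≤ t := hS ▸ card_le_card sdiff_subset
    have h2 : (t - (S \ b).card).factorial * (u + 1).ascFactorial (S \ b).card ≤ v ^ t := by
      calc _ ≤ v ^ (t - (S \ b).card) * v ^ (S \ b).card := by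
            apply Nat.mul_le_mul
            · exact (Nat.factorial_le_pow _).trans (Nat.pow_le_pow_left (by omega) _)
            · exact (Nat.ascFactorial_le_pow_add _ _).trans (Nat.pow_le_pow_left (by omega) _)
        _ = v ^ t := by rw [← pow_add]; congr 1; omega
    rw [decoderCoeff, Int.cast_mul, abs_mul]
    simp only [Int.cast_pow, Int.cast_neg, Int.cast_one, abs_pow, abs_neg, abs_one, one_pow,
      one_mul, Int.cast_natCast, Nat.abs_cast]
    exact_mod_cast h2
  refine (sum_le_sum fun b _ => h1 b).trans ?_
  rw [sum_const, nsmul_eq_mul, sq, card_powersetCard, card_union_of_disjoint h, hS, hW]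
  apply mul_le_mul_of_nonneg_right _ (by positivity)
  rw [← Nat.choose_symm_add]
  exact_mod_cast (Nat.choose_le_pow _ _).trans (Nat.pow_le_pow_left (by omega) _)

open Finset in
/-- If all induced weights `∑ S ⊆ b, θ S` are near integers, then their fractional parts are
induced by a real weight that agrees with `θ` up to multiples of `1 / (t! (k choose t))`. -/
theorem exists_int_eq_of_near {v t u l : ℕ} {θ : Finset (Fin v) → ℝ} {p r : ℝ}
    (hv : t + u + 1 + t ≤ v)
    (hp : p * ((v - t).choose (u + 1) : ℕ) = (t.factorial * (t + u + 1).choose t * l : ℕ))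
    (hr : ((v : ℝ) ^ t + ((v : ℝ) ^ t) ^ 3) * r < 1)
    {y : Finset (Fin v) → ℝ} (hy : ∀ b ∈ univ.powersetCard (t + u + 1), |y b| ≤ r)
    (hyθ : ∀ b, ∃ n : ℤ, ∑ S ∈ b.powersetCard t, θ S - y b = n) :
    ∃ n : ℤ, (t.factorial * (t + u + 1).choose t * l : ℕ) * ∑ S ∈ univ.powersetCard t, θ S
      - p * ∑ b ∈ univ.powersetCard (t + u + 1), y b = n := by
  set D : ℕ := t.factorial * (t + u + 1).choose t with hD
  have hDpos : 0 < D := Nat.mul_pos (Nat.factorial_pos _) (Nat.choose_pos (by omega))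
  have hD0 : (D : ℝ) ≠ 0 := by exact_mod_cast hDpos.ne'
  have hDV : (D : ℝ) ≤ (v : ℝ) ^ t := by
    have : D ≤ v ^ t := by
      rw [hD, ← Nat.descFactorial_eq_factorial_mul_choose]
      exact (Nat.descFactorial_le_pow _ _).trans (Nat.pow_le_pow_left (by omega) _)
    exact_mod_cast this
  have hWex : ∀ S : Finset (Fin v), ∃ W : Finset (Fin v), S.card = t →
      Disjoint S W ∧ W.card = t + u + 1 := by
    intro S
    by_cases hS : S.card = t
    · obtain ⟨W, hW, hWc⟩ := exists_subset_card_eq (s := Sᶜ) (n := t + u + 1) (by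
        rw [card_compl, Fintype.card_fin, hS]; omega)
      exact ⟨W, fun _ => ⟨disjoint_of_subset_right hW disjoint_compl_right, hWc⟩⟩
    · exact ⟨∅, fun h => absurd h hS⟩
  choose W hW using hWex
  choose n hn using hyθ
  -- The decoder applied to y instead of ψ; its coefficients are integers, so E S and D θ S differ
  -- by an integer.
  set E : Finset (Fin v) → ℝ := fun S =>
    ∑ b ∈ (S ∪ W S).powersetCard (t + u + 1), (decoderCoeff t u S b : ℝ) * y b with hE
  have hr0 : 0 ≤ r := by
    obtain ⟨b, -, hb⟩ := exists_subset_card_eq (s := (univ : Finset (Fin v))) (n := t + u + 1)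
      (by rw [card_univ, Fintype.card_fin]; omega)
    exact (abs_nonneg _).trans (hy b (mem_powersetCard.2 ⟨subset_univ _, hb⟩))
  have hEabs : ∀ S : Finset (Fin v), S.card = t → |E S| ≤ ((v : ℝ) ^ t) ^ 2 * r := by
    intro S hS
    refine (abs_sum_le_sum_abs _ _).trans (le_trans ?_ (mul_le_mul_of_nonneg_right
      (sum_abs_decoderCoeff_le (hW S hS).1 hS (hW S hS).2 hv) hr0))
    rw [sum_mul]
    refine sum_le_sum fun b hb => ?_
    rw [abs_mul]
    refine mul_le_mul_of_nonneg_left (hy b ?_) (abs_nonneg _)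
    exact mem_powersetCard.2 ⟨subset_univ _, (mem_powersetCard.1 hb).2⟩
  have hEint : ∀ S : Finset (Fin v), ∃ m : ℤ, S.card = t → D * θ S - E S = m := by
    intro S
    refine ⟨∑ b ∈ (S ∪ W S).powersetCard (t + u + 1), decoderCoeff t u S b * n b, fun hS => ?_⟩
    rw [hD, ← sum_decoderCoeff_mul (hW S hS).1 hS (hW S hS).2 θ, hE, ← sum_sub_distrib]
    push_cast
    refine sum_congr rfl fun b _ => ?_
    rw [← hn b]; ring
  choose m hm using hEint
  -- The two sides differ by an integer of absolute value at most (V + V³)r < 1, hence agree.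
  have hlift : ∀ b ∈ univ.powersetCard (t + u + 1), D * y b = ∑ S ∈ b.powersetCard t, E S := by
    intro b hb
    have hbc := (mem_powersetCard.1 hb).2
    have h1 : D * y b - ∑ S ∈ b.powersetCard t, E S
        = ((∑ S ∈ b.powersetCard t, m S - D * n b : ℤ) : ℝ) := by
      push_cast
      rw [← hn b, ← sum_congr rfl fun S hS => hm S (mem_powersetCard.1 hS).2, sum_sub_distrib,
        ← mul_sum]
      ring
    have h2 : |D * y b - ∑ S ∈ b.powersetCard t, E S| < 1 := by
      refine lt_of_le_of_lt ?_ hr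
      refine (abs_sub _ _).trans ?_
      rw [add_mul, abs_mul, Nat.abs_cast]
      refine add_le_add (mul_le_mul hDV (hy b hb) (abs_nonneg _) (by positivity)) ?_
      refine (abs_sum_le_sum_abs _ _).trans
        ((sum_le_sum fun S hS => hEabs S (mem_powersetCard.1 hS).2).trans ?_)
      rw [sum_const, nsmul_eq_mul, card_powersetCard, hbc, pow_succ' _ 2, mul_assoc]
      apply mul_le_mul_of_nonneg_right _ (by positivity)
      exact_mod_cast (Nat.choose_le_pow _ _).trans (Nat.pow_le_pow_left (by omega) _)
    rw [h1] at h2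
    have h3 : (∑ S ∈ b.powersetCard t, m S - D * n b : ℤ) = 0 := by
      rw [← Int.abs_lt_one_iff]; exact_mod_cast h2
    rw [h3, Int.cast_zero] at h1
    linarith
  have hsum : D * ∑ b ∈ univ.powersetCard (t + u + 1), y b
      = ((v - t).choose (u + 1) : ℕ) * ∑ S ∈ univ.powersetCard t, E S := by
    rw [mul_sum, sum_congr rfl hlift]
    have h1 : ∀ b ∈ (univ : Finset (Fin v)).powersetCard (t + u + 1), ∑ S ∈ b.powersetCard t, E S
        = ∑ S ∈ univ.powersetCard t, if S ⊆ b then E S else 0 := by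
      intro b _
      rw [← sum_filter]
      congr 1
      ext S
      simp only [mem_powersetCard, mem_filter, subset_univ, true_and]
      tauto
    rw [sum_congr rfl h1, sum_comm, mul_sum]
    refine sum_congr rfl fun S hS => ?_
    have hSc := (mem_powersetCard.1 hS).2
    have h2 := card_filter_powersetCard_subset S univ (t + u + 1) (subset_univ _) (by omega)
    rw [card_univ, Fintype.card_fin, hSc, show t + u + 1 - t = u + 1 by omega] at h2
    rw [← sum_filter, sum_const, nsmul_eq_mul, h2]
  -- By `hsum` and `hp`, p ∑ y = l ∑ E, so the difference is l ∑ (D θ - E).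
  refine ⟨l * ∑ S ∈ univ.powersetCard t, m S, ?_⟩
  have h1 : ∑ S ∈ univ.powersetCard t, (m S : ℝ)
      = D * ∑ S ∈ univ.powersetCard t, θ S - ∑ S ∈ univ.powersetCard t, E S := by
    rw [mul_sum, ← sum_sub_distrib]
    exact sum_congr rfl fun S hS => (hm S (mem_powersetCard.1 hS).2).symm
  push_cast at hp ⊢
  rw [h1]
  apply mul_left_cancel₀ hD0
  linear_combination (-p) * hsum - (∑ S ∈ univ.powersetCard t, E S) * hp

/-- The summand of the Fourier expansion, for `p`-random families of `k`-sets, of the probability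
that every `t`-set is covered `l` times, at the frequency `θ`. -/
noncomputable def fourierTerm (v t k l : ℕ) (p : ℝ) (θ : Finset (Fin v) → ℝ) : ℂ :=
  cis (-(l * ∑ S ∈ Finset.univ.powersetCard t, θ S)) *
    ∏ b ∈ Finset.univ.powersetCard k, (((1 - p : ℝ) : ℂ) + p * cis (∑ S ∈ b.powersetCard t, θ S))

open Finset in
theorem fourierTerm_eq_of_near {v t u l : ℕ} {θ : Finset (Fin v) → ℝ} {p r : ℝ}
    (hv : t + u + 1 + t ≤ v)
    (hp : p * ((v - t).choose (u + 1) : ℕ) = (t.factorial * (t + u + 1).choose t * l : ℕ))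
    (hr : ((v : ℝ) ^ t + ((v : ℝ) ^ t) ^ 3) * r < 1)
    {y : Finset (Fin v) → ℝ} (hy : ∀ b ∈ univ.powersetCard (t + u + 1), |y b| ≤ r)
    (hyθ : ∀ b, ∃ n : ℤ, ∑ S ∈ b.powersetCard t, θ S - y b = n) :
    fourierTerm v t (t + u + 1) (t.factorial * (t + u + 1).choose t * l) p θ
      = ∏ b ∈ univ.powersetCard (t + u + 1), (cis (-(p * y b)) * (((1 - p : ℝ) : ℂ) + p * cis (y b))) := by
  obtain ⟨n, hn⟩ := exists_int_eq_of_near hv hp hr hy hyθ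
  rw [fourierTerm, prod_mul_distrib, ← cis_sum, sum_neg_distrib, ← mul_sum]
  congr 1
  · exact cis_eq_of_sub_int ⟨-n, by push_cast [← hn]; ring⟩
  · exact prod_congr rfl fun b _ => by rw [cis_eq_of_sub_int (hyθ b)]

-- The norm on ℝ/ℤ is the distance to the nearest integer, so the slice bound applies with K = v.
-- Each k-set it yields contributes a decay factor exp(-4pε²); other factors have norm at most 1.
open Finset in
theorem norm_fourierTerm_le {v t k l : ℕ} {θ : Finset (Fin v) → ℝ} {p r : ℝ} (hp0 : 0 ≤ p)
    (hp : p ≤ 1 / 2) (hr : 0 < r) (htk : t ≤ k) (hv : k + t ≤ v)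
    (hfar : ∃ b ∈ univ.powersetCard k,
      r < |∑ S ∈ b.powersetCard t, θ S - round (∑ S ∈ b.powersetCard t, θ S)|) :
    ‖fourierTerm v t k l p θ‖
      ≤ Real.exp (-(4 * p * ((v - 2 * t).choose (k - t) : ℕ) * (r / (2 * v + 1) ^ t) ^ 2)) := by
  set ψ : Finset (Fin v) → ℝ := fun b => ∑ S ∈ b.powersetCard t, θ S with hψ
  set ε := r / (2 * v + 1 : ℝ) ^ t with hε
  have hε0 : 0 < ε := by positivity
  have hnorm : ∀ b, ‖∑ S ∈ b.powersetCard t, (θ S : UnitAddCircle)‖ = |ψ b - round (ψ b)| := by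
    intro b
    rw [← UnitAddCircle.norm_eq, hψ]
    congr 1
    exact (map_sum (QuotientAddGroup.mk' (AddSubgroup.zmultiples (1 : ℝ))) θ _).symm
  have hmany := choose_le_card_large_norm v t k univ (fun S => (θ S : UnitAddCircle)) ε hε0 htk
    (by omega) (by rw [card_univ, Fintype.card_fin]; exact hv) (by
      obtain ⟨b, hb, hlt⟩ := hfar
      refine ⟨b, hb, ?_⟩
      rw [hnorm, hε, mul_div_cancel₀ _ (by positivity)]
      exact hlt)
  rw [card_univ, Fintype.card_fin] at hmany
  simp only [hnorm] at hmany
  rw [fourierTerm, norm_mul, norm_cis, one_mul, norm_prod]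
  have hle : ∀ b ∈ (univ : Finset (Fin v)).powersetCard k,
      ‖((1 - p : ℝ) : ℂ) + p * cis (ψ b)‖
        ≤ Real.exp (if ε < |ψ b - round (ψ b)| then -(4 * p * ε ^ 2) else 0) := by
    intro b _
    have h1 := norm_bernoulli_char_le hp0 hp (abs_sub_round (ψ b))
    rw [← cis_eq_of_sub_int (x := ψ b) ⟨round (ψ b), by ring⟩] at h1
    refine h1.trans (Real.exp_le_exp.2 ?_)
    split_ifs with h
    · have h2 : ε ^ 2 ≤ (ψ b - round (ψ b)) ^ 2 := by
        rw [← sq_abs (ψ b - round (ψ b))]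
        exact pow_le_pow_left₀ hε0.le h.le 2
      have := mul_le_mul_of_nonneg_left h2 (show 0 ≤ 4 * p by linarith)
      linarith
    · exact neg_nonpos.2 (by positivity)
  refine (prod_le_prod (fun b _ => norm_nonneg _) hle).trans ?_
  rw [← Real.exp_sum, ← sum_filter, sum_const, nsmul_eq_mul]
  refine Real.exp_le_exp.2 ?_
  have h3 := mul_le_mul_of_nonneg_right (Nat.cast_le (α := ℝ).2 hmany)
    (show 0 ≤ 4 * p * ε ^ 2 by positivity)
  linarith

/-! ### Positivity and choice of parameters -/

open Finset in
/-- Positivity of the sum of the Fourier terms gives a design. -/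
theorem exists_design_of_fourier_sum_pos {v t k l Q : ℕ} {p : ℝ} (hQ : v.choose k + l < Q)
    (hpos : 0 < (∑ a : {S : Finset (Fin v) // S.card = t} → Fin Q,
      fourierTerm v t k l p fun S => if h : S.card = t then ((a ⟨S, h⟩ : ℕ) / Q : ℝ) else 0).re) :
    ∃ T : Finset (Finset (Fin v)), IsSimpleDesign t v k l T := by
  have hcount : ∀ (T : Finset (Finset (Fin v))) (S : Finset (Fin v)),
      ∑ b ∈ T, (if S ⊆ b then (1 : ℤ) else 0) = ((T.filter fun b => S ⊆ b).card : ℤ) := by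
    intro T S
    rw [card_filter]; push_cast; rfl
  obtain ⟨T, hT, hTl⟩ := exists_subset_sum_eq ((univ : Finset (Fin v)).powersetCard k)
    (fun b (S : {S : Finset (Fin v) // S.card = t}) => if S.1 ⊆ b then (1 : ℤ) else 0)
    (fun _ => (l : ℤ)) p Q (by
      intro T hT S
      rw [hcount]
      have h1 : (T.filter fun b => S.1 ⊆ b).card ≤ v.choose k := by
        refine (card_filter_le _ _).trans ((card_le_card hT).trans_eq ?_)
        rw [card_powersetCard, card_univ, Fintype.card_fin]
      rw [abs_lt]
      constructor <;> omega) (by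
      convert hpos using 4 with a _
      rw [fourierTerm]
      have hext : ∀ (A : Finset (Finset (Fin v))), (∀ S ∈ A, S.card = t) →
          ∑ S ∈ A, (if h : S.card = t then ((a ⟨S, h⟩ : ℕ) / Q : ℝ) else 0)
            = ∑ i : {S : Finset (Fin v) // S.card = t}, if i.1 ∈ A then ((a i : ℕ) / Q : ℝ) else 0 := by
        intro A hA
        have h1 := sum_subtype (F := inferInstance) (univ.powersetCard t) (p := fun S : Finset (Fin v) => S.card = t)
          (fun S => by simp [mem_powersetCard])
          (fun S => if S ∈ A then (if h : S.card = t then ((a ⟨S, h⟩ : ℕ) / Q : ℝ) else 0) else 0)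
        rw [← sum_filter] at h1
        have h2 : (univ.powersetCard t).filter (fun S => S ∈ A) = A := by
          ext S
          simp only [mem_filter, mem_powersetCard, subset_univ, true_and]
          exact ⟨fun h => h.2, fun h => ⟨hA S h, h⟩⟩
        rw [h2] at h1
        rw [h1]
        exact sum_congr rfl fun i _ => by rw [dif_pos i.2]
      congr 1
      · rw [hext _ fun S hS => (mem_powersetCard.1 hS).2, mul_sum]
        congr 2
        refine sum_congr rfl fun i _ => ?_
        rw [if_pos (mem_powersetCard.2 ⟨subset_univ _, i.2⟩)]
        push_cast; rfl
      · refine prod_congr rfl fun b _ => ?_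
        rw [hext _ fun S hS => (mem_powersetCard.1 hS).2]
        congr 3
        refine sum_congr rfl fun i _ => ?_
        simp [mem_powersetCard, i.2])
  refine ⟨T, fun s hs => (mem_powersetCard.1 (hT hs)).2, fun S hS => ?_⟩
  have := hTl ⟨S, hS⟩
  rw [hcount] at this
  exact_mod_cast this

theorem natCast_pow_le_exp {V : ℝ} (hV : 0 ≤ V) (d : ℕ) : V ^ d ≤ Real.exp (d * V) := by
  rw [Real.exp_nat_mul]
  exact pow_le_pow_left₀ hV ((le_add_of_nonneg_right zero_le_one).trans (Real.add_one_le_exp V)) d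

open Finset in
theorem IsSimpleDesign.card_le {t v k l : ℕ} {T : Finset (Finset (Fin v))} (htk : t ≤ k)
    (h : IsSimpleDesign t v k l T) : T.card ≤ l * v.choose t := by
  have h1 : T ⊆ (univ.powersetCard t).biUnion fun S => T.filter fun b => S ⊆ b := by
    intro b hb
    obtain ⟨S, hS, hSc⟩ := exists_subset_card_eq (s := b) (n := t) (by rw [h.card_block b hb]; exact htk)
    exact mem_biUnion.2 ⟨S, mem_powersetCard.2 ⟨subset_univ _, hSc⟩, mem_filter.2 ⟨hb, hS⟩⟩
  refine (card_le_card h1).trans (card_biUnion_le.trans_eq ?_)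
  rw [sum_congr rfl fun S hS => h.card_blocks_through S (mem_powersetCard.1 hS).2, sum_const,
    card_powersetCard, card_univ, Fintype.card_fin, smul_eq_mul, mul_comm]

open Finset in
theorem isSimpleDesign_powersetCard {t v k : ℕ} (htk : t ≤ k) :
    IsSimpleDesign t v k ((v - t).choose (k - t)) ((univ : Finset (Fin v)).powersetCard k) := by
  refine ⟨fun s hs => (mem_powersetCard.1 hs).2, fun S hS => ?_⟩
  rw [card_filter_powersetCard_subset S univ k (subset_univ _) (by omega), card_univ,
    Fintype.card_fin, hS]

open Finset in
/-- Positivity of the Fourier sum: frequencies whose induced weights are all near integers have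
nonnegative real part, the others are negligible, and the frequencies with entries in
`[0, 1 / W)` form a fraction `W ^ (-(v choose t))` of all and contribute at least `1 / 4` each. -/
theorem fourier_sum_pos {v t u l M W : ℕ} {p r : ℝ} (hv : t + u + 1 + t ≤ v)
    (hpl : p * ((v - t).choose (u + 1) : ℕ) = (t.factorial * (t + u + 1).choose t * l : ℕ))
    (hp0 : 0 ≤ p) (hp : p ≤ 1 / 2) (hr0 : 0 < r) (hr7 : 7 * r ≤ 1)
    (hr1 : ((v : ℝ) ^ t + ((v : ℝ) ^ t) ^ 3) * r < 1)
    (hNr : 750 * (p * v.choose (t + u + 1)) * r ^ 3 ≤ 1) (hM : 0 < M) (hW : 0 < W)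
    (hWr : ((t + u + 1).choose t : ℝ) / W ≤ r)
    (hNW : 20 * (p * v.choose (t + u + 1)) * (((t + u + 1).choose t : ℝ) / W) ^ 2 ≤ 1 / 2)
    (hmain : (W : ℝ) ^ v.choose t * (4 * Real.exp (-(4 * p *
      ((v - 2 * t).choose (t + u + 1 - t) : ℕ) * (r / (2 * v + 1) ^ t) ^ 2))) < 1) :
    0 < (∑ a : {S : Finset (Fin v) // S.card = t} → Fin (W * M),
      fourierTerm v t (t + u + 1) (t.factorial * (t + u + 1).choose t * l) p
        fun S => if h : S.card = t then ((a ⟨S, h⟩ : ℕ) / (W * M : ℕ) : ℝ) else 0).re := by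
  set E : ℝ := Real.exp (-(4 * p *
      ((v - 2 * t).choose (t + u + 1 - t) : ℕ) * (r / (2 * v + 1) ^ t) ^ 2)) with hE
  have hE0 : 0 < E := Real.exp_pos _
  have hlow' : ∀ θ : Finset (Fin v) → ℝ, (∃ b ∈ univ.powersetCard (t + u + 1),
      r < |∑ S ∈ b.powersetCard t, θ S - round (∑ S ∈ b.powersetCard t, θ S)|) →
      -E ≤ (fourierTerm v t (t + u + 1) (t.factorial * (t + u + 1).choose t * l) p θ).re := by
    intro θ h
    exact (abs_le.1 ((Complex.abs_re_le_norm _).trans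
      (norm_fourierTerm_le hp0 hp hr0 (by omega) hv h))).1
  have hcardB : (((univ : Finset (Fin v)).powersetCard (t + u + 1)).card : ℝ)
      = v.choose (t + u + 1) := by
    rw [card_powersetCard, card_univ, Fintype.card_fin]
  have hnear : ∀ θ : Finset (Fin v) → ℝ, (∀ b ∈ univ.powersetCard (t + u + 1),
      |∑ S ∈ b.powersetCard t, θ S - round (∑ S ∈ b.powersetCard t, θ S)| ≤ r) →
      0 ≤ (fourierTerm v t (t + u + 1) (t.factorial * (t + u + 1).choose t * l) p θ).re ∧
      (1 - 20 * p * ∑ b ∈ univ.powersetCard (t + u + 1),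
        (∑ S ∈ b.powersetCard t, θ S - round (∑ S ∈ b.powersetCard t, θ S)) ^ 2) / 2
        ≤ (fourierTerm v t (t + u + 1) (t.factorial * (t + u + 1).choose t * l) p θ).re := by
    intro θ h
    rw [fourierTerm_eq_of_near (r := r)
      (y := fun b => ∑ S ∈ b.powersetCard t, θ S - round (∑ S ∈ b.powersetCard t, θ S)) hv hpl hr1 h
      fun b => ⟨round (∑ S ∈ b.powersetCard t, θ S), by ring⟩]
    exact re_prod_centered_bernoulli_char _ hp0 hp h hr7 (by rw [hcardB]; exact hNr)
  have hlow : ∀ θ, -E ≤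
      (fourierTerm v t (t + u + 1) (t.factorial * (t + u + 1).choose t * l) p θ).re := by
    intro θ
    by_cases h : ∀ b ∈ univ.powersetCard (t + u + 1),
        |∑ S ∈ b.powersetCard t, θ S - round (∑ S ∈ b.powersetCard t, θ S)| ≤ r
    · linarith [(hnear θ h).1]
    · push Not at h
      exact hlow' θ h
  have hhigh : ∀ θ : Finset (Fin v) → ℝ, (∀ S, 0 ≤ θ S ∧ θ S ≤ (W : ℝ)⁻¹) →
      1 / 4 ≤ (fourierTerm v t (t + u + 1) (t.factorial * (t + u + 1).choose t * l) p θ).re := by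
    intro θ hθ
    have hψ : ∀ b ∈ univ.powersetCard (t + u + 1),
        |∑ S ∈ b.powersetCard t, θ S| ≤ ((t + u + 1).choose t : ℝ) / W := by
      intro b hb
      rw [abs_of_nonneg (sum_nonneg fun S _ => (hθ S).1)]
      refine (sum_le_sum fun S _ => (hθ S).2).trans_eq ?_
      rw [sum_const, nsmul_eq_mul, card_powersetCard, (mem_powersetCard.1 hb).2, div_eq_mul_inv]
    have hround : ∀ b ∈ univ.powersetCard (t + u + 1),
        ∑ S ∈ b.powersetCard t, θ S - round (∑ S ∈ b.powersetCard t, θ S)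
          = ∑ S ∈ b.powersetCard t, θ S := by
      intro b hb
      have h1 : round (∑ S ∈ b.powersetCard t, θ S) = 0 := by
        rw [round_eq_zero_iff]
        have := abs_le.1 ((hψ b hb).trans hWr)
        constructor <;> linarith
      rw [h1, Int.cast_zero, sub_zero]
    refine le_trans ?_ (hnear θ fun b hb => by rw [hround b hb]; exact (hψ b hb).trans hWr).2
    rw [sum_congr rfl fun b hb => by rw [hround b hb]]
    have h2 : ∑ b ∈ univ.powersetCard (t + u + 1), (∑ S ∈ b.powersetCard t, θ S) ^ 2
        ≤ v.choose (t + u + 1) * (((t + u + 1).choose t : ℝ) / W) ^ 2 := by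
      rw [← hcardB, ← nsmul_eq_mul, ← sum_const]
      refine sum_le_sum fun b hb => ?_
      rw [← sq_abs]
      exact pow_le_pow_left₀ (abs_nonneg _) (hψ b hb) 2
    have h3 := mul_le_mul_of_nonneg_left h2 (show 0 ≤ 20 * p by linarith)
    linarith
  -- With Q = WM, numerators below M give exactly a 1/W share of each coordinate.
  set G : Finset ({S : Finset (Fin v) // S.card = t} → Fin (W * M)) :=
    Fintype.piFinset fun _ => univ.filter fun c : Fin (W * M) => (c : ℕ) < M with hG
  have hWR : (0 : ℝ) < W := by exact_mod_cast hW
  have hMR : (0 : ℝ) < M := by exact_mod_cast hM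
  have hG1 : ∀ a ∈ G, ∀ S : Finset (Fin v),
      0 ≤ (if h : S.card = t then ((a ⟨S, h⟩ : ℕ) / (W * M : ℕ) : ℝ) else 0) ∧
      (if h : S.card = t then ((a ⟨S, h⟩ : ℕ) / (W * M : ℕ) : ℝ) else 0) ≤ (W : ℝ)⁻¹ := by
    intro a ha S
    split_ifs with hS
    · refine ⟨by positivity, ?_⟩
      have h1 : (a ⟨S, hS⟩ : ℕ) < M := (mem_filter.1 (Fintype.mem_piFinset.1 ha ⟨S, hS⟩)).2
      have h2 : ((a ⟨S, hS⟩ : ℕ) : ℝ) ≤ M := by exact_mod_cast h1.le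
      rw [Nat.cast_mul, div_le_iff₀ (by positivity), inv_mul_cancel_left₀ hWR.ne']
      exact h2
    · exact ⟨le_rfl, by positivity⟩
  have hGcard : (G.card : ℝ) = (M : ℝ) ^ v.choose t := by
    rw [hG, Fintype.card_piFinset]
    have h1 : (univ.filter fun c : Fin (W * M) => (c : ℕ) < M).card = M := by
      rw [Fin.card_filter_val_lt, min_eq_right (Nat.le_mul_of_pos_left _ hW)]
    rw [prod_const, h1, card_univ, Fintype.card_finset_len, Fintype.card_fin]
    push_cast; rfl
  have hAcard : ((univ : Finset ({S : Finset (Fin v) // S.card = t} → Fin (W * M))).card : ℝ)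
      = (W : ℝ) ^ v.choose t * (M : ℝ) ^ v.choose t := by
    rw [card_univ, Fintype.card_fun, Fintype.card_fin, Fintype.card_finset_len, Fintype.card_fin]
    push_cast
    rw [mul_pow]
  rw [Complex.re_sum]
  -- Every term is at least -E, and at least 1/4 on G, so 1/4 · 1_G - E is a pointwise lower bound.
  refine lt_of_lt_of_le ?_ (sum_le_sum (f := fun a => (if a ∈ G then (1 / 4 : ℝ) else 0) - E)
    fun a _ => ?_)
  · rw [sum_sub_distrib, ← sum_filter, filter_mem_eq_inter, univ_inter, sum_const, sum_const,
      nsmul_eq_mul, nsmul_eq_mul, hGcard, hAcard]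
    have h1 := mul_lt_mul_of_pos_left hmain (show (0 : ℝ) < (M : ℝ) ^ v.choose t by positivity)
    linarith
  · change ite _ _ _ - E ≤ _
    split_ifs with ha
    · exact (sub_le_self _ hE0.le).trans (hhigh _ (hG1 a ha))
    · rw [zero_sub]; exact hlow _

-- Exponents of V = v^t: the mean size N lies between V^79 and V^80, and r = V^(-30) makes N r³ at
-- most V^(-10). The far exponent is at least 4 V^77 V^(-66) = 4V^11, which beats W^(v choose t) ≤
-- exp(44V²) for W = V^44. On the small box the variance is O(V^80 V^(-86)).
open Finset in
theorem exists_design_of_pow_le_choose {v t u : ℕ} (ht : 1 ≤ t) (hv : t + u + 1 + t ≤ v)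
    (hB : 2 * (v ^ t) ^ 80 ≤ v.choose (t + u + 1)) :
    ∃ T : Finset (Finset (Fin v)),
      IsSimpleDesign t v (t + u + 1) (t.factorial * (t + u + 1).choose t * (v ^ t) ^ 79) T := by
  set k := t + u + 1 with hk
  set l := t.factorial * k.choose t * (v ^ t) ^ 79 with hl
  set V : ℝ := (v : ℝ) ^ t with hV
  have hv2 : (2 : ℝ) ≤ v := by exact_mod_cast (show 2 ≤ v by omega)
  have hV2 : 2 ≤ V := by
    calc (2 : ℝ) ≤ v := hv2
      _ = (v : ℝ) ^ 1 := (pow_one _).symm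
      _ ≤ V := pow_le_pow_right₀ (by linarith) ht
  have hV0 : 0 < V := by linarith
  have hBV : 2 * V ^ 80 ≤ (v.choose k : ℝ) := by rw [hV]; exact_mod_cast hB
  have hB0 : (0 : ℝ) < v.choose k := lt_of_lt_of_le (by positivity) hBV
  -- The falling factorial is t! (v choose t), which makes the mean cover exactly t! (k choose t)
  -- V^79.
  set N : ℝ := (v.descFactorial t : ℝ) * V ^ 79 with hN
  have hNle : N ≤ V ^ 80 := by
    have : (v.descFactorial t : ℝ) ≤ V := by rw [hV]; exact_mod_cast Nat.descFactorial_le_pow v t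
    rw [hN, pow_succ' V 79]
    exact mul_le_mul_of_nonneg_right this (by positivity)
  have hNge : V ^ 79 ≤ N := by
    have : (1 : ℝ) ≤ v.descFactorial t := by
      exact_mod_cast Nat.pos_of_ne_zero (by rw [Ne, Nat.descFactorial_eq_zero_iff_lt]; omega)
    rw [hN]
    exact le_mul_of_one_le_left (by positivity) this
  set p : ℝ := N / v.choose k with hpdef
  have hpB : p * (v.choose k : ℝ) = N := div_mul_cancel₀ _ hB0.ne'
  have hp0 : 0 ≤ p := by positivity
  have hp : p ≤ 1 / 2 := by rw [hpdef, div_le_iff₀ hB0]; linarith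
  have hpl : p * ((v - t).choose (u + 1) : ℕ) = (l : ℕ) := by
    have h1 := congrArg (Nat.cast : ℕ → ℝ) (Nat.choose_mul (n := v) (k := k) (s := t) (by omega))
    rw [show k - t = u + 1 by omega] at h1
    push_cast at h1
    have h2 : N = (t.factorial * v.choose t * V ^ 79 : ℝ) := by
      rw [hN, Nat.descFactorial_eq_factorial_mul_choose]; push_cast; ring
    have h3 : (l : ℝ) = t.factorial * k.choose t * V ^ 79 := by
      rw [hl, hV]; push_cast; ring
    apply mul_right_cancel₀ hB0.ne'
    rw [h3]
    linear_combination ((v - t).choose (u + 1) : ℝ) * hpB + ((v - t).choose (u + 1) : ℝ) * h2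
      - (t.factorial : ℝ) * V ^ 79 * h1
  have hpow : ∀ n : ℕ, (2 : ℝ) ^ n ≤ V ^ n := fun n => pow_le_pow_left₀ (by norm_num) hV2 n
  set r : ℝ := (V ^ 30)⁻¹ with hr
  have hr0 : 0 < r := by positivity
  have hrV : V ^ 30 * r = 1 := mul_inv_cancel₀ (by positivity)
  have hr7 : 7 * r ≤ 1 := by
    rw [← hrV]; exact mul_le_mul_of_nonneg_right (by linarith [hpow 30]) hr0.le
  have hr1 : (V + V ^ 3) * r < 1 := by
    rw [← hrV]
    refine mul_lt_mul_of_pos_right ?_ hr0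
    have h1 : V ^ 30 = V ^ 3 * V ^ 27 := by ring
    have h2 : V ≤ V ^ 3 := le_self_pow₀ (by linarith) (by norm_num)
    have h3 : V ^ 3 * 4 ≤ V ^ 3 * V ^ 27 :=
      mul_le_mul_of_nonneg_left (by linarith [hpow 27]) (by positivity)
    have h4 : 0 < V ^ 3 := by positivity
    linarith
  have hNr : 750 * N * r ^ 3 ≤ 1 := by
    have h1 : V ^ 90 * r ^ 3 = 1 := by
      rw [show V ^ 90 = (V ^ 30) ^ 3 by ring, ← mul_pow, hrV, one_pow]
    rw [← h1, show V ^ 90 = V ^ 80 * V ^ 10 by ring]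
    refine mul_le_mul_of_nonneg_right ?_ (by positivity)
    have h2 : V ^ 80 * 750 ≤ V ^ 80 * V ^ 10 :=
      mul_le_mul_of_nonneg_left (by linarith [hpow 10]) (by positivity)
    linarith
  set E : ℝ := Real.exp (-(4 * p * ((v - 2 * t).choose (k - t) : ℕ) * (r / (2 * v + 1) ^ t) ^ 2))
    with hE
  have hEle : E ≤ Real.exp (-(4 * V ^ 11)) := by
    refine Real.exp_le_exp.2 (neg_le_neg ?_)
    have h1 : N ≤ p * ((v - 2 * t).choose (k - t) : ℕ) * V ^ 2 := by
      rw [← hpB, mul_assoc]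
      refine mul_le_mul_of_nonneg_left ?_ hp0
      rw [mul_comm _ (V ^ 2), hV]
      exact_mod_cast choose_le_pow_mul_choose_sub (show t ≤ k by omega) hv
    have h2 : V ^ 77 ≤ p * ((v - 2 * t).choose (k - t) : ℕ) := by
      have : V ^ 77 * V ^ 2 ≤ p * ((v - 2 * t).choose (k - t) : ℕ) * V ^ 2 := by
        rw [← pow_add]; exact hNge.trans h1
      exact le_of_mul_le_mul_right this (by positivity)
    have h3 : (2 * v + 1 : ℝ) ^ t ≤ V ^ 3 := by
      rw [hV, ← pow_mul, mul_comm t 3, pow_mul]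
      refine pow_le_pow_left₀ (by positivity) ?_ t
      nlinarith [mul_nonneg (show (0 : ℝ) ≤ v - 2 by linarith) (sq_nonneg (v : ℝ)),
        mul_nonneg (show (0 : ℝ) ≤ v - 2 by linarith) (show (0 : ℝ) ≤ v by linarith)]
    have h4 : (V ^ 33)⁻¹ ≤ r / (2 * v + 1) ^ t := by
      rw [hr, div_eq_mul_inv, ← mul_inv]
      refine inv_anti₀ (by positivity) ?_
      rw [show V ^ 33 = V ^ 30 * V ^ 3 by ring]
      exact mul_le_mul_of_nonneg_left h3 (by positivity)
    have h5 : V ^ 11 = V ^ 77 * ((V ^ 33)⁻¹) ^ 2 := by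
      field_simp
    have h6 := mul_le_mul h2 (pow_le_pow_left₀ (by positivity) h4 2) (by positivity) (by positivity)
    rw [h5]
    linarith
  set d := v.choose t with hd
  have hdV : (d : ℝ) ≤ V := by rw [hV, hd]; exact_mod_cast Nat.choose_le_pow v t
  have hmain : V ^ (44 * d) * (4 * E) < 1 := by
    have h1 : V ^ (44 * d) ≤ Real.exp (44 * V ^ 2) := by
      refine (natCast_pow_le_exp hV0.le _).trans (Real.exp_le_exp.2 ?_)
      push_cast
      nlinarith
    have h2 : (4 : ℝ) ≤ Real.exp 2 := by
      have := Real.add_one_le_exp (1 : ℝ)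
      rw [show (2 : ℝ) = 1 + 1 by norm_num, Real.exp_add]
      nlinarith
    calc V ^ (44 * d) * (4 * E)
        ≤ Real.exp (44 * V ^ 2) * (Real.exp 2 * Real.exp (-(4 * V ^ 11))) := by
          gcongr
      _ = Real.exp (44 * V ^ 2 + 2 - 4 * V ^ 11) := by
          rw [← Real.exp_add, ← Real.exp_add]; congr 1; ring
      _ < 1 := by
          rw [Real.exp_lt_one_iff]
          have h3 : V ^ 11 = V ^ 2 * V ^ 9 := by ring
          have h4 : V ^ 2 * 512 ≤ V ^ 2 * V ^ 9 :=
            mul_le_mul_of_nonneg_left (by linarith [hpow 9]) (by positivity)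
          nlinarith [hpow 2]
  have hChoose : (k.choose t : ℝ) ≤ V := by
    rw [hV]
    exact_mod_cast (Nat.choose_le_pow k t).trans (Nat.pow_le_pow_left (by omega) _)
  have hC44 : (k.choose t : ℝ) / V ^ 44 ≤ (V ^ 43)⁻¹ := by
    refine (div_le_div_of_nonneg_right hChoose (by positivity)).trans_eq ?_
    field_simp
  have hWV : (((v ^ t) ^ 44 : ℕ) : ℝ) = V ^ 44 := by rw [hV]; push_cast; rfl
  have hvt : 0 < v ^ t := Nat.pow_pos (by omega)
  refine exists_design_of_fourier_sum_pos (Q := (v ^ t) ^ 44 * (v.choose k + l + 1)) (p := p)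
    (lt_of_lt_of_le (Nat.lt_succ_self _) (Nat.le_mul_of_pos_left _ (Nat.pow_pos hvt)))
    (fourier_sum_pos hv hpl hp0 hp hr0 hr7 hr1 ?_ (Nat.succ_pos _) (Nat.pow_pos hvt) ?_ ?_ ?_)
  · rw [hpB]; exact hNr
  · rw [hWV, hr]
    exact hC44.trans (inv_anti₀ (by positivity) (pow_le_pow_right₀ (by linarith) (by norm_num)))
  · rw [hWV, hpB]
    have h1 : N * ((k.choose t : ℝ) / V ^ 44) ^ 2 ≤ (V ^ 6)⁻¹ := by
      calc N * ((k.choose t : ℝ) / V ^ 44) ^ 2 ≤ V ^ 80 * ((V ^ 43)⁻¹) ^ 2 := by gcongr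
        _ = (V ^ 6)⁻¹ := by field_simp
    have h2 : (V ^ 6)⁻¹ ≤ 1 / 64 := by
      rw [one_div]
      exact inv_anti₀ (by norm_num) (by linarith [hpow 6])
    linarith
  · rw [hWV, ← pow_mul]; exact hmain

theorem theorem1p2 :
    ∃ c : ℝ, 0 < c ∧ ∀ v t k : ℕ, 1 ≤ v → 1 ≤ t → t ≤ v → t ≤ k → k ≤ v →
      ∃ l : ℕ, 1 ≤ l ∧ ∃ T : Finset (Finset (Fin v)),
        IsSimpleDesign t v k l T ∧ (T.card : ℝ) ≤ (v : ℝ) ^ (c * (t : ℝ)) := by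
  -- For the random design, l ≤ V · V^79, and counting blocks through t-sets costs one more factor
  -- (v choose t) ≤ V.
  refine ⟨81, by norm_num, fun v t k hv1 ht htv htk hkv => ?_⟩
  suffices h : ∃ l : ℕ, 1 ≤ l ∧ ∃ T : Finset (Finset (Fin v)),
      IsSimpleDesign t v k l T ∧ T.card ≤ (v ^ t) ^ 81 by
    obtain ⟨l, hl, T, hT, hcard⟩ := h
    refine ⟨l, hl, T, hT, ?_⟩
    rw [mul_comm, ← Nat.cast_ofNat (n := 81), ← Nat.cast_mul, Real.rpow_natCast, pow_mul]
    exact_mod_cast hcard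
  have hV : 1 ≤ v ^ t := Nat.one_le_pow _ _ hv1
  -- The complete design covers k = t, v - k < t, and (v choose k) < 2V^80.
  have hcomplete : v.choose k ≤ (v ^ t) ^ 81 → ∃ l : ℕ, 1 ≤ l ∧ ∃ T : Finset (Finset (Fin v)),
      IsSimpleDesign t v k l T ∧ T.card ≤ (v ^ t) ^ 81 := fun h =>
    ⟨_, Nat.choose_pos (by omega), _, isSimpleDesign_powersetCard htk, by
      rwa [Finset.card_powersetCard, Finset.card_univ, Fintype.card_fin]⟩
  have hself : v ^ t ≤ (v ^ t) ^ 81 := Nat.le_self_pow (by norm_num) _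
  rcases Nat.eq_or_lt_of_le htk with rfl | hlt
  · exact hcomplete ((Nat.choose_le_pow _ _).trans hself)
  rcases Nat.lt_or_ge v (k + t) with hkt | hkt
  · refine hcomplete (le_trans ?_ hself)
    rw [← Nat.choose_symm hkv]
    exact (Nat.choose_le_pow _ _).trans (Nat.pow_le_pow_right hv1 (by omega))
  obtain ⟨u, rfl⟩ : ∃ u, k = t + u + 1 := ⟨k - t - 1, by omega⟩
  have hV2 : 2 ≤ v ^ t :=
    (show 2 ≤ v by omega).trans (Nat.le_self_pow (by omega) v)
  rcases Nat.lt_or_ge (v.choose (t + u + 1)) (2 * (v ^ t) ^ 80) with hB | hB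
  · refine hcomplete (hB.le.trans ?_)
    rw [pow_succ' _ 80]
    exact Nat.mul_le_mul_right _ hV2
  obtain ⟨T, hT⟩ := exists_design_of_pow_le_choose ht hkt hB
  refine ⟨_, ?_, T, hT, (hT.card_le htk).trans ?_⟩
  · exact Nat.mul_pos (Nat.mul_pos (Nat.factorial_pos _) (Nat.choose_pos htk)) (by positivity)
  · have h1 : t.factorial * (t + u + 1).choose t ≤ v ^ t := by
      rw [← Nat.descFactorial_eq_factorial_mul_choose]
      exact (Nat.descFactorial_le_pow _ _).trans (Nat.pow_le_pow_left hkv _)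
    calc _ ≤ v ^ t * (v ^ t) ^ 79 * v ^ t :=
          Nat.mul_le_mul (Nat.mul_le_mul_right _ h1) (Nat.choose_le_pow _ _)
      _ = (v ^ t) ^ 81 := by ring
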